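/- Graphs are finite and undirected, with positive real edge weights; parallel edges are allowed (an unweighted graph has all weights $1$). A \emph{cut} of a graph is the set of edges crossing a partition of its vertex set into two nonempty parts; its \emph{value} is the total weight of its edges. For real $\alpha\ge 1$, a cut is \emph{$\alpha$-minimum} if its value is at most $\alpha$ times the minimum value of a cut of the graph. \textbf{Theorem.} (1) For every integer $k$ there is a constant $K$ such that for every real $\alpha\ge 1$ with $\lfloor 2\alpha\rfloor=k$ and every graph with $n\ge k$ vertices, the number of $\alpha$-minimum cuts is at most $$\frac{1}{\lfloor 2\alpha\rfloor+1-2\alpha}\binom{n}{\lfloor 2\alpha\rfloor}\Bigl(1+\frac{K}{n}\Bigr).$$ (2) Consequently, for every fixed $\alpha\ge1$ the bound has the right order of growth: as $n\to\infty$, the maximum number of $\alpha$-minimum cuts of an $n$-vertex graph is $\Theta\bigl(n^{\lfloor 2\alpha\rfloor}\bigr)$. (3) For comparison, for every $\alpha\ge1$ and $n\ge2$ the unweighted cycle on $n$ vertices (for $n=2$, two parallel edges) has exactly $\sum_{j=1}^{\lfloor\alpha\rfloor}\binom{n}{2j}$ $\alpha$-minimum cuts. When $\lfloor 2\alpha\rfloor$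 is even this is $\binom n2+\binom n4+\cdots+\binom{n}{\lfloor 2\alpha\rfloor}=\Theta\bigl(n^{\lfloor 2\alpha\rfloor}\bigr)$, so the cycle itself attains the order of growth in (2). -/

import Mathlib

open scoped Graph

/-- A finite undirected multigraph (parallel edges and loops allowed, not necessarily connected)
with a positive real weight on every edge. An unweighted graph is one with all weights `1`. -/
structure WeightedGraph (V E : Type*) where
  graph : Graph V E
  weight : E → ℝ
  finite_vertexSet : V(graph).Finite
  finite_edgeSet : E(graph).Finite
  weight_pos : ∀ e ∈ E(graph), 0 < weight e

namespace WeightedGraph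

variable {V E : Type*}

/-- The number of vertices. -/
noncomputable def order (G : WeightedGraph V E) : ℕ := V(G.graph).ncard

/-- The set of edges crossing the vertex partition `(S, V(G) \ S)`. -/
def crossing (G : WeightedGraph V E) (S : Set V) : Set E :=
  {e | ∃ x ∈ S, ∃ y ∈ V(G.graph) \ S, G.graph.IsLink e x y}

/-- The (two-way) cuts of `G`: the edge sets that are the set of edges crossing
some partition of the vertex set into two nonempty parts. -/
def cuts (G : WeightedGraph V E) : Set (Set E) :=
  {F | ∃ S ⊆ V(G.graph), S.Nonempty ∧ (V(G.graph) \ S).Nonempty ∧ F = G.crossing S}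

/-- The value of a set of edges: its total weight. -/
noncomputable def cutValue (G : WeightedGraph V E) (F : Set E) : ℝ := ∑ᶠ e ∈ F, G.weight e

/-- The minimum cut value. (The infimum is over finitely many values, and over at least one
as soon as `G` has two vertices, so it is then a minimum.) -/
noncomputable def minCutValue (G : WeightedGraph V E) : ℝ := sInf (G.cutValue '' G.cuts)

/-- The `α`-minimum cuts: those of value at most `α` times the minimum cut value. -/
def alphaMinCuts (G : WeightedGraph V E) (α : ℝ) : Set (Set E) :=
  {F ∈ G.cuts | G.cutValue F ≤ α * G.minCutValue}

/-- The number of `α`-minimum cuts (there are only finitely many cuts). -/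
noncomputable def numAlphaMinCuts (G : WeightedGraph V E) (α : ℝ) : ℕ := (G.alphaMinCuts α).ncard

/-- The unweighted cycle on `n` vertices: for each `i` modulo `n`, the edge `i` joins the
vertices `i` and `i + 1`. (For `n = 2` this is a pair of parallel edges.) -/
def cycle (n : ℕ) [NeZero n] : WeightedGraph (ZMod n) (ZMod n) where
  graph :=
    { vertexSet := Set.univ
      IsLink := fun i x y => (x = i ∧ y = i + 1) ∨ (x = i + 1 ∧ y = i)
      isLink_symm := fun _ _ => ⟨fun _ _ h => h.elim (fun h => .inr ⟨h.2, h.1⟩)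
        (fun h => .inl ⟨h.2, h.1⟩)⟩
      eq_or_eq_of_isLink_of_isLink := by
        rintro e x y v w (⟨rfl, rfl⟩ | ⟨rfl, rfl⟩) (⟨rfl, rfl⟩ | ⟨rfl, rfl⟩) <;> simp
      left_mem_of_isLink := fun _ _ _ _ => Set.mem_univ _ }
  weight := fun _ => 1
  finite_vertexSet := Set.toFinite _
  finite_edgeSet := Set.toFinite _
  weight_pos := fun _ _ => one_pos

/-- The largest number of `α`-minimum cuts that a weighted graph on `n` vertices can have.
(Every finite graph is isomorphic to one whose vertices and edges are natural numbers.) -/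
noncomputable def maxNumAlphaMinCuts (α : ℝ) (n : ℕ) : ℕ :=
  sSup {N | ∃ G : WeightedGraph ℕ ℕ, G.order = n ∧ N = G.numAlphaMinCuts α}

end WeightedGraph

/-! Let `c > 0` be the minimum cut value. Some random spanning tree `T` contains each edge `e` with
probability at most `2 * w e / c`, so an `α`-minimum cut `F` meets `T` in at most `2α` edges on
average, and the positive part of `k + 1 - |F ∩ T|` has mean at least `k + 1 - 2α`. For a fixed
tree, `F ∩ T` determines `F`, so these positive parts, added over all `F`, are at most the same sum
over all subsets of the `n - 1` tree edges. Averaging over `T` gives `card_cuts_mul_le`; with `k =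
⌊2α⌋`, the term `j = k` dominates.

The random tree comes from duality: it suffices that for all edge lengths `l ≥ 0` some tree has
length at most `(2 / c) * ∑ w e * l e` (`exists_isSpanningTree_sum_le`).

For the matching lower bound, take `k` nearly equal paths between two hubs: the minimum cut is at
least 2, and one edge from each path gives a cut of value `k ≤ 2α`, in order `n ^ k` ways. In a
cycle, the cuts are exactly the nonempty edge sets of even size. -/

/-! ### Fractional packing of spanning trees -/

/-- The edges of the multigraph with endpoint maps `s`, `t` that cross the bipartition `f`. -/
def cutEdges {V E : Type*} [Fintype E] (s t : E → V) (f : V → Bool) : Finset E :=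
  Finset.univ.filter fun e => f (s e) ≠ f (t e)

/-- A spanning tree of the multigraph with endpoint maps `s`, `t`: a set of `|V| - 1` edges, none
of them a loop, that meets every cut. -/
structure IsSpanningTree {V E : Type*} [Fintype V] (s t : E → V) (T : Finset E) : Prop where
  card_add_one : T.card + 1 = Fintype.card V
  ne : ∀ e ∈ T, s e ≠ t e
  eq_of_forall_eq : ∀ f : V → Bool, (∀ e ∈ T, f (s e) = f (t e)) → ∀ x y, f x = f y

/-- The star of each vertex is a cut; summed over the vertices, a non-loop is counted twice and a
loop never. -/
theorem card_mul_le_two_mul_sum_weight {V E : Type*} [Fintype V] [DecidableEq V] [Nontrivial V]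
    [Fintype E] (s t : E → V) (w : E → ℝ) (c : ℝ)
    (hcut : ∀ f : V → Bool, (∃ x y, f x ≠ f y) → c ≤ ∑ e ∈ cutEdges s t f, w e) :
    (Fintype.card V : ℝ) * c ≤ 2 * ∑ e with s e ≠ t e, w e := by
  have h1 : ∀ v : V, c ≤ ∑ e ∈ cutEdges s t (fun x => decide (x = v)), w e := by
    intro v
    obtain ⟨u, hu⟩ := exists_ne v
    exact hcut _ ⟨v, u, by simp [hu]⟩
  have h2 : (Fintype.card V : ℝ) * c ≤
      ∑ v : V, ∑ e ∈ cutEdges s t (fun x => decide (x = v)), w e := by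
    have := Finset.sum_le_sum fun v (_ : v ∈ (Finset.univ : Finset V)) => h1 v
    simpa using this
  refine h2.trans (le_of_eq ?_)
  simp only [cutEdges, Finset.sum_filter]
  rw [Finset.sum_comm, Finset.mul_sum]
  refine Finset.sum_congr rfl fun e _ => ?_
  by_cases he : s e = t e
  · simp [he]
  · have h3 : ∀ v, (if decide (s e = v) ≠ decide (t e = v) then w e else 0) =
        (if s e = v then w e else 0) + (if t e = v then w e else 0) := by
      intro v
      by_cases h : s e = v <;> by_cases h' : t e = v <;> simp [h, h']
      exact absurd (h.trans h'.symm) he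
    rw [Finset.sum_congr rfl fun v _ => h3 v, Finset.sum_add_distrib]
    simp [he]
    ring

/-- Kruskal's greedy choice: contract a shortest non-loop `e₀` and lower all lengths by `l e₀`. On
the tree this saves `(m + 1) * l e₀`; on the right it saves `l e₀` times the total non-loop weight,
which is at least `(m + 2) * c / 2`. Cuts of the contracted graph are cuts of the original. -/
theorem exists_isSpanningTree_sum_le {E : Type*} [Fintype E] (w : E → ℝ) (hw : ∀ e, 0 ≤ w e)
    {c : ℝ} (hc : 0 < c) (m : ℕ) :
    ∀ (V : Type*) [Fintype V], Fintype.card V = m + 1 → ∀ (s t : E → V) (l : E → ℝ),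
      (∀ e, 0 ≤ l e) →
      (∀ f : V → Bool, (∃ x y, f x ≠ f y) → c ≤ ∑ e ∈ cutEdges s t f, w e) →
      ∃ T : Finset E, IsSpanningTree s t T ∧ c / 2 * ∑ e ∈ T, l e ≤ ∑ e, w e * l e := by
  classical
  induction m with
  | zero =>
    intro V _ hV s t l hl _
    have : Subsingleton V := Fintype.card_le_one_iff_subsingleton.mp (by omega)
    refine ⟨∅, ⟨by simp [hV], by simp, fun f _ x y => by rw [Subsingleton.elim x y]⟩, ?_⟩
    simpa using Finset.sum_nonneg fun e _ => mul_nonneg (hw e) (hl e)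
  | succ m ih =>
    intro V _ hV s t l hl hcut
    have : Nontrivial V := Fintype.one_lt_card_iff_nontrivial.mp (by omega)
    have htot := card_mul_le_two_mul_sum_weight s t w c hcut
    have hne : (Finset.univ.filter fun e => s e ≠ t e).Nonempty := by
      by_contra h
      rw [Finset.not_nonempty_iff_eq_empty] at h
      rw [h, Finset.sum_empty, mul_zero, hV] at htot
      have : 0 < ((m + 1 + 1 : ℕ) : ℝ) * c := by positivity
      linarith
    obtain ⟨e₀, he₀, hmin⟩ := Finset.exists_min_image _ l hne
    replace he₀ : s e₀ ≠ t e₀ := by simpa using he₀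
    replace hmin : ∀ e, s e ≠ t e → l e₀ ≤ l e := fun e he => hmin e (by simpa using he)
    let π : V → {v // v ≠ t e₀} := fun v => if h : v = t e₀ then ⟨s e₀, he₀⟩ else ⟨v, h⟩
    have hπ : ∀ x : {v // v ≠ t e₀}, π x = x := fun x => by simp [π, x.2]
    have hπ₀ : π (s e₀) = π (t e₀) := by simp [π, he₀]
    have hcard : Fintype.card {v // v ≠ t e₀} = m + 1 := by
      simp [Fintype.card_subtype_compl, hV]
    -- Existing loops may be shorter than `e₀`; truncating at 0 keeps their new lengths nonnegative.
    obtain ⟨T, hT, hTl⟩ := ih {v // v ≠ t e₀} hcard (π ∘ s) (π ∘ t)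
      (fun e => max (l e - l e₀) 0) (fun e => le_max_right _ _) (by
        rintro f ⟨x, y, hxy⟩
        exact hcut (f ∘ π) ⟨x, y, by simpa [hπ] using hxy⟩)
    have heT : e₀ ∉ T := fun h => hT.ne e₀ h hπ₀
    have hneT : ∀ e ∈ T, s e ≠ t e := fun e he h => hT.ne e he (congrArg π h)
    refine ⟨insert e₀ T, ⟨?_, ?_, ?_⟩, ?_⟩
    · rw [Finset.card_insert_of_notMem heT, hT.card_add_one, hcard, hV]
    · intro e he
      rcases Finset.mem_insert.mp he with rfl | he
      · exact he₀
      · exact hneT e he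
    · intro f hf
      have hfπ : ∀ v, f (π v) = f v := by
        intro v
        by_cases h : v = t e₀
        · simp [π, h, hf e₀ (Finset.mem_insert_self _ _)]
        · simp [π, h]
      have := hT.eq_of_forall_eq (fun x => f x) fun e he => by
        simpa [hfπ] using hf e (Finset.mem_insert_of_mem he)
      intro x y
      simpa [hfπ] using this (π x) (π y)
    · have h1 : ∑ e ∈ insert e₀ T, l e =
          ∑ e ∈ T, max (l e - l e₀) 0 + (m + 1) * l e₀ := by
        have hTc : (T.card : ℝ) = m := by
          have := hT.card_add_one
          rw [hcard] at this
          exact_mod_cast Nat.succ_injective this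
        have : ∑ e ∈ T, l e = ∑ e ∈ T, (max (l e - l e₀) 0 + l e₀) :=
          Finset.sum_congr rfl fun e he => by
            rw [max_eq_left (sub_nonneg.mpr (hmin e (hneT e he))), sub_add_cancel]
        rw [Finset.sum_insert heT, this, Finset.sum_add_distrib, Finset.sum_const, nsmul_eq_mul,
          hTc]
        ring
      have h2 : ∑ e, w e * max (l e - l e₀) 0 + (∑ e with s e ≠ t e, w e) * l e₀ ≤
          ∑ e, w e * l e := by
        rw [Finset.sum_filter, Finset.sum_mul, ← Finset.sum_add_distrib]
        refine Finset.sum_le_sum fun e _ => ?_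
        by_cases he : s e = t e
        · simp only [he, ne_eq, not_true_eq_false, if_false, zero_mul, add_zero]
          exact mul_le_mul_of_nonneg_left (max_le (by linarith [hl e₀]) (hl e)) (hw e)
        · rw [if_pos he, max_eq_left (sub_nonneg.mpr (hmin e he))]
          exact le_of_eq (by ring)
      have h3 : c / 2 * ((m + 1) * l e₀) ≤ (∑ e with s e ≠ t e, w e) * l e₀ := by
        rw [← mul_assoc]
        refine mul_le_mul_of_nonneg_right ?_ (hl e₀)
        rw [hV] at htot
        push_cast at htot
        nlinarith
      rw [h1, mul_add]
      linarith

/-- Fractional packing of spanning trees: if every cut has weight at least `c > 0`, then there is a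
probability distribution on the spanning trees under which each edge `e` is chosen with probability
at most `2 * w e / c`. -/
theorem exists_spanningTree_distribution {V E : Type*} [Fintype V] [Nonempty V] [Fintype E]
    [DecidableEq E] (s t : E → V) (w : E → ℝ) (hw : ∀ e, 0 ≤ w e) {c : ℝ} (hc : 0 < c)
    (hcut : ∀ f : V → Bool, (∃ x y, f x ≠ f y) → c ≤ ∑ e ∈ cutEdges s t f, w e) :
    ∃ p : Finset E → ℝ, (∀ T, 0 ≤ p T) ∧ ∑ T, p T = 1 ∧ (∀ T, p T ≠ 0 → IsSpanningTree s t T) ∧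
      ∀ e, ∑ T, (if e ∈ T then p T else 0) ≤ 2 * w e / c := by
  classical
  let τ := {T : Finset E // IsSpanningTree s t T}
  let L : (τ → ℝ) →ₗ[ℝ] (E → ℝ) :=
    LinearMap.pi fun e => ∑ T : τ, if e ∈ T.1 then LinearMap.proj T else 0
  have hL : ∀ p e, L p e = ∑ T : τ, if e ∈ T.1 then p T else 0 := by
    intro p e
    simp only [L, LinearMap.pi_apply, LinearMap.sum_apply]
    refine Finset.sum_congr rfl fun T _ => ?_
    split_ifs <;> rfl
  have key : ∃ p ∈ stdSimplex ℝ τ, ∀ e, L p e ≤ 2 * w e / c := by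
    by_contra! hcon
    have hdisj : Disjoint (L '' stdSimplex ℝ τ) (Set.Iic fun e => 2 * w e / c) := by
      rw [Set.disjoint_left]
      rintro _ ⟨p, hp, rfl⟩ hle
      obtain ⟨e, he⟩ := hcon p hp
      exact absurd (hle e) (not_le.mpr he)
    -- If no distribution works, a hyperplane separates the mean incidence vectors of trees from the
    -- vectors below `2 * w / c`. The negated coefficients of `φ` serve as edge lengths.
    obtain ⟨φ, u, v, hu, huv, hv⟩ := geometric_hahn_banach_compact_closed
      ((convex_stdSimplex ℝ τ).linear_image L)
      ((isCompact_stdSimplex ℝ τ).image L.continuous_of_finiteDimensional)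
      (convex_Iic _) isClosed_Iic hdisj
    let l : E → ℝ := fun e => -φ (Pi.single e 1)
    have hφ : ∀ x : E → ℝ, φ x = -∑ e, x e * l e := by
      intro x
      conv_lhs => rw [pi_eq_sum_univ' x, map_sum]
      simp only [map_smul, smul_eq_mul, l, mul_neg, Finset.sum_neg_distrib, neg_neg]
    -- The orthant is unbounded below, so a negative length would let `φ` drop to `v` on it.
    have hl : ∀ e, 0 ≤ l e := by
      intro e
      by_contra! hneg
      obtain ⟨r, hr0, hr⟩ : ∃ r : ℝ, 0 ≤ r ∧
          φ (fun e => 2 * w e / c) + r * l e ≤ v := by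
        refine ⟨max 0 ((v - φ (fun e => 2 * w e / c)) / l e), le_max_left _ _, ?_⟩
        have := mul_le_mul_of_nonpos_right
          (le_max_right 0 ((v - φ (fun e => 2 * w e / c)) / l e)) hneg.le
        rw [div_mul_cancel₀ _ hneg.ne] at this
        linarith
      have h := hv ((fun e => 2 * w e / c) - r • Pi.single e 1) (by
        intro e'
        simp only [Pi.sub_apply, Pi.smul_apply, smul_eq_mul]
        have : 0 ≤ r * (Pi.single e 1 : E → ℝ) e' :=
          mul_nonneg hr0 (by by_cases h : e' = e <;> simp [h])
        linarith)
      rw [map_sub, map_smul, smul_eq_mul] at h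
      simp only [l] at hr
      linarith
    obtain ⟨T, hT, hTl⟩ := exists_isSpanningTree_sum_le w hw hc (Fintype.card V - 1) V
      (Nat.sub_add_cancel Fintype.card_pos).symm s t l hl hcut
    have h1 := hu _ ⟨Pi.single (⟨T, hT⟩ : τ) 1, single_mem_stdSimplex ℝ _, rfl⟩
    have h2 := hv (fun e => 2 * w e / c) Set.self_mem_Iic
    rw [hφ] at h1 h2
    have h3 : ∑ e, L (Pi.single (⟨T, hT⟩ : τ) 1) e * l e = ∑ e ∈ T, l e := by
      have h : ∀ e, L (Pi.single (⟨T, hT⟩ : τ) 1) e = if e ∈ T then 1 else 0 := by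
        intro e
        rw [hL, Finset.sum_eq_single ⟨T, hT⟩ (fun T' _ h => by simp [h]) (by simp)]
        simp
      simp [h]
    have h4 : ∑ e, 2 * w e / c * l e = 2 / c * ∑ e, w e * l e := by
      rw [Finset.mul_sum]
      exact Finset.sum_congr rfl fun e _ => by ring
    rw [h3] at h1
    rw [h4] at h2
    have h5 : ∑ e ∈ T, l e ≤ 2 / c * ∑ e, w e * l e := by
      rw [div_mul_eq_mul_div, le_div_iff₀ hc]
      linarith
    linarith
  obtain ⟨p, ⟨hp0, hp1⟩, hp⟩ := key
  -- The distribution is extended by zero to edge sets that are not spanning trees.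
  have hsum : ∀ g : Finset E → ℝ → ℝ, (∀ T, g T 0 = 0) →
      ∑ T, g T (if h : IsSpanningTree s t T then p ⟨T, h⟩ else 0) = ∑ T : τ, g T.1 (p T) := by
    intro g hg
    rw [← Fintype.sum_subtype_add_sum_subtype (IsSpanningTree s t), add_eq_left.mpr]
    · exact Finset.sum_congr rfl fun T _ => by rw [dif_pos T.2]
    · exact Finset.sum_eq_zero fun T _ => by rw [dif_neg T.2, hg]
  refine ⟨fun T => if h : IsSpanningTree s t T then p ⟨T, h⟩ else 0, ?_, ?_, ?_, ?_⟩
  · intro T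
    dsimp only
    split_ifs
    exacts [hp0 _, le_rfl]
  · rw [← hp1]
    exact hsum (fun _ x => x) fun _ => rfl
  · intro T hT
    by_contra h
    simp [h] at hT
  · intro e
    refine le_trans (le_of_eq ?_) (hp e)
    rw [hL]
    exact hsum (fun T x => if e ∈ T then x else 0) (by simp)

/-! ### Counting cuts by their traces on a random tree -/

/-- If two cuts agree on the tree, the xor of their bipartitions is constant along tree edges, hence
everywhere. -/
theorem injOn_inter_of_isSpanningTree {V E : Type*} [Fintype V] [Fintype E] [DecidableEq E]
    {s t : E → V} {T : Finset E} (hT : IsSpanningTree s t T) :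
    Set.InjOn (fun F => F ∩ T) (Set.range (cutEdges s t)) := by
  rintro _ ⟨f, rfl⟩ _ ⟨g, rfl⟩ h
  have key : ∀ e, (f (s e) ≠ f (t e) ↔ g (s e) ≠ g (t e)) ↔
      xor (f (s e)) (g (s e)) = xor (f (t e)) (g (t e)) := by
    intro e
    cases f (s e) <;> cases f (t e) <;> cases g (s e) <;> cases g (t e) <;> simp
  have hconst := hT.eq_of_forall_eq (fun x => xor (f x) (g x)) fun e he => by
    rw [← key]
    simpa [cutEdges, he] using Finset.ext_iff.mp h e
  ext e
  simpa [cutEdges] using (key e).mpr (hconst _ _)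

theorem card_cuts_mul_le {V E : Type*} [Fintype V] [Nonempty V] [Fintype E] [DecidableEq E]
    (s t : E → V) (w : E → ℝ) (hw : ∀ e, 0 ≤ w e) {c : ℝ} (hc : 0 < c)
    (hcut : ∀ f : V → Bool, (∃ x y, f x ≠ f y) → c ≤ ∑ e ∈ cutEdges s t f, w e)
    (α : ℝ) (k : ℕ) (A : Finset (Finset E))
    (hA : ∀ F ∈ A, F ∈ Set.range (cutEdges s t) ∧ ∑ e ∈ F, w e ≤ α * c) :
    (k + 1 - 2 * α) * A.card ≤
      ∑ j ∈ Finset.range (k + 1), ((Fintype.card V - 1).choose j * (k + 1 - j) : ℕ) := by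
  obtain ⟨p, hp0, hp1, hpT, hpe⟩ := exists_spanningTree_distribution s t w hw hc hcut
  -- Truncated subtraction in `ℕ` is the positive part.
  have hF : ∀ F ∈ A, (k + 1 - 2 * α : ℝ) ≤ ∑ T, p T * ((k + 1 - (F ∩ T).card : ℕ) : ℝ) := by
    intro F hF
    have h1 : ∑ T, p T * ((F ∩ T).card : ℝ) ≤ 2 * α := by
      calc ∑ T, p T * ((F ∩ T).card : ℝ)
          = ∑ e ∈ F, ∑ T, (if e ∈ T then p T else 0) := by
            rw [Finset.sum_comm]
            refine Finset.sum_congr rfl fun T _ => ?_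
            rw [← Finset.sum_filter, Finset.filter_mem_eq_inter, Finset.sum_const, nsmul_eq_mul,
              mul_comm]
        _ ≤ ∑ e ∈ F, 2 * w e / c := Finset.sum_le_sum fun e _ => hpe e
        _ = 2 / c * ∑ e ∈ F, w e := by
            rw [Finset.mul_sum]
            exact Finset.sum_congr rfl fun e _ => by ring
        _ ≤ 2 * α := by
            rw [div_mul_eq_mul_div, div_le_iff₀ hc]
            linarith [(hA F hF).2]
    calc (k + 1 - 2 * α : ℝ) ≤ (k + 1) * ∑ T, p T - ∑ T, p T * ((F ∩ T).card : ℝ) := by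
          rw [hp1]
          linarith
      _ = ∑ T, p T * ((k + 1 : ℝ) - (F ∩ T).card) := by
          rw [Finset.mul_sum, ← Finset.sum_sub_distrib]
          exact Finset.sum_congr rfl fun T _ => by ring
      _ ≤ _ := Finset.sum_le_sum fun T _ => mul_le_mul_of_nonneg_left
          (by rw [sub_le_iff_le_add]; exact_mod_cast le_tsub_add) (hp0 T)
  have hT : ∀ T, p T ≠ 0 → ∑ F ∈ A, (k + 1 - (F ∩ T).card) ≤
      ∑ j ∈ Finset.range (k + 1), (Fintype.card V - 1).choose j * (k + 1 - j) := by
    intro T hT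
    have hTree := hpT T hT
    have hcard : T.card = Fintype.card V - 1 := by
      rw [← hTree.card_add_one, Nat.add_sub_cancel]
    have hinj : Set.InjOn (fun F => F ∩ T) A :=
      (injOn_inter_of_isSpanningTree hTree).mono fun F hF => (hA F hF).1
    calc ∑ F ∈ A, (k + 1 - (F ∩ T).card)
        = ∑ B ∈ A.image (fun F => F ∩ T), (k + 1 - B.card) :=
          (Finset.sum_image (f := fun B => k + 1 - B.card) hinj).symm
      _ ≤ ∑ B ∈ T.powerset, (k + 1 - B.card) := by
          refine Finset.sum_le_sum_of_subset fun B hB => ?_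
          obtain ⟨F, _, rfl⟩ := Finset.mem_image.mp hB
          exact Finset.mem_powerset.mpr Finset.inter_subset_right
      _ = ∑ j ∈ Finset.range (T.card + 1), T.card.choose j * (k + 1 - j) := by
          rw [Finset.sum_powerset_apply_card (fun j => k + 1 - j)]
          simp
      _ ≤ _ := by
          rw [hcard]
          refine Finset.sum_le_sum_of_ne_zero fun j _ hj => ?_
          rw [Finset.mem_range]
          by_contra! h
          exact hj (by rw [Nat.sub_eq_zero_of_le h, mul_zero])
  calc (k + 1 - 2 * α) * A.card = ∑ F ∈ A, (k + 1 - 2 * α) := by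
        rw [Finset.sum_const, nsmul_eq_mul, mul_comm]
    _ ≤ ∑ F ∈ A, ∑ T, p T * ((k + 1 - (F ∩ T).card : ℕ) : ℝ) := Finset.sum_le_sum hF
    _ = ∑ T, p T * ((∑ F ∈ A, (k + 1 - (F ∩ T).card) : ℕ) : ℝ) := by
        rw [Finset.sum_comm]
        push_cast
        exact Finset.sum_congr rfl fun T _ => by rw [Finset.mul_sum]
    _ ≤ ∑ T, p T * ((∑ j ∈ Finset.range (k + 1),
          (Fintype.card V - 1).choose j * (k + 1 - j) : ℕ) : ℝ) := by
        refine Finset.sum_le_sum fun T _ => ?_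
        by_cases h : p T = 0
        · simp [h]
        · exact mul_le_mul_of_nonneg_left (by exact_mod_cast hT T h) (hp0 T)
    _ = _ := by rw [← Finset.sum_mul, hp1, one_mul]

/-- The term `j = k` is at most `n.choose k`. Each of the `k` others is at most `(n - 1).choose (k -
1) * 2 ^ (k - 1) * (k + 1)`, and `(n - 1).choose (k - 1) = n.choose k * k / n`. -/
theorem sum_choose_mul_le {n k : ℕ} (hk : 1 ≤ k) (hkn : k ≤ n) :
    ((∑ j ∈ Finset.range (k + 1), (n - 1).choose j * (k + 1 - j) : ℕ) : ℝ) ≤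
      n.choose k * (1 + (k * (k + 1) * 2 ^ (k - 1) * k : ℕ) / n) := by
  obtain ⟨k, rfl⟩ := Nat.exists_eq_add_of_le' hk
  obtain ⟨n, rfl⟩ := Nat.exists_eq_add_of_le' (hk.trans hkn)
  simp only [Nat.add_sub_cancel]
  have hkn' : k ≤ n := by omega
  have h1 : ∀ j ∈ Finset.range (k + 1), n.choose j * (k + 1 + 1 - j) ≤
      n.choose k * 2 ^ k * (k + 1 + 1) := by
    intro j hj
    have hjk : j ≤ k := by simpa [Nat.lt_succ_iff] using hj
    refine Nat.mul_le_mul ?_ (Nat.sub_le _ _)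
    calc n.choose j ≤ n.choose j * (n - j).choose (k - j) :=
          Nat.le_mul_of_pos_right _ (Nat.choose_pos (by omega))
      _ = n.choose k * k.choose j := (Nat.choose_mul hjk).symm
      _ ≤ n.choose k * 2 ^ k := Nat.mul_le_mul_left _ (Nat.choose_le_two_pow _ _)
  have h2 : ∑ j ∈ Finset.range (k + 1 + 1), n.choose j * (k + 1 + 1 - j) ≤
      (k + 1) * (n.choose k * 2 ^ k * (k + 1 + 1)) + (n + 1).choose (k + 1) := by
    rw [Finset.sum_range_succ]
    refine add_le_add ((Finset.sum_le_sum h1).trans (by simp)) ?_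
    rw [Nat.add_sub_cancel_left, mul_one]
    exact Nat.choose_le_choose _ (Nat.le_succ n)
  have h3 : (n.choose k : ℝ) = (n + 1).choose (k + 1) * (k + 1) / (n + 1) := by
    rw [eq_div_iff (by positivity)]
    have := Nat.add_one_mul_choose_eq n k
    rw [mul_comm]
    exact_mod_cast this
  refine (Nat.cast_le.mpr h2).trans (le_of_eq ?_)
  push_cast
  rw [h3]
  ring

/-! ### The upper bound for weighted graphs -/

namespace WeightedGraph

variable {V E : Type*}

theorem crossing_subset_edgeSet (G : WeightedGraph V E) (S : Set V) :
    G.crossing S ⊆ E(G.graph) := by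
  rintro e ⟨x, _, y, _, h⟩
  exact h.edge_mem

theorem crossing_eq (G : WeightedGraph V E) {S : Set V} {e : E} {x y : V}
    (h : G.graph.IsLink e x y) : e ∈ G.crossing S ↔ ¬ (x ∈ S ↔ y ∈ S) := by
  constructor
  · rintro ⟨a, ha, b, hb, hab⟩
    rcases h.eq_and_eq_or_eq_and_eq hab with ⟨rfl, rfl⟩ | ⟨rfl, rfl⟩
    · exact fun hiff => hb.2 (hiff.mp ha)
    · exact fun hiff => hb.2 (hiff.mpr ha)
  · intro hiff
    by_cases hx : x ∈ S
    · exact ⟨x, hx, y, ⟨h.right_mem, fun hy => hiff ⟨fun _ => hy, fun _ => hx⟩⟩, h⟩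
    · have hy : y ∈ S := by tauto
      exact ⟨y, hy, x, ⟨h.left_mem, hx⟩, h.symm⟩

theorem cutValue_nonneg (G : WeightedGraph V E) {F : Set E} (hF : F ⊆ E(G.graph)) :
    0 ≤ G.cutValue F :=
  finsum_nonneg fun e => finsum_nonneg fun he => (G.weight_pos e (hF he)).le

theorem subset_edgeSet_of_mem_cuts (G : WeightedGraph V E) {F : Set E} (hF : F ∈ G.cuts) :
    F ⊆ E(G.graph) := by
  obtain ⟨S, -, -, -, rfl⟩ := hF
  exact G.crossing_subset_edgeSet S

theorem minCutValue_le (G : WeightedGraph V E) {F : Set E} (hF : F ∈ G.cuts) :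
    G.minCutValue ≤ G.cutValue F :=
  csInf_le ⟨0, by
    rintro _ ⟨F, hF, rfl⟩
    exact G.cutValue_nonneg (G.subset_edgeSet_of_mem_cuts hF)⟩ ⟨F, hF, rfl⟩

theorem eq_empty_of_cutValue_nonpos (G : WeightedGraph V E) {F : Set E} (hF : F ⊆ E(G.graph))
    (h : G.cutValue F ≤ 0) : F = ∅ := by
  by_contra hne
  obtain ⟨e, he⟩ := Set.nonempty_iff_ne_empty.mpr hne
  have hfin : F.Finite := G.finite_edgeSet.subset hF
  have : 0 < G.cutValue F := by
    rw [cutValue, finsum_mem_eq_finite_toFinset_sum _ hfin]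
    exact Finset.sum_pos (fun e he => G.weight_pos e (hF (hfin.mem_toFinset.mp he)))
      ⟨e, hfin.mem_toFinset.mpr he⟩
  linarith

/-- The disconnected case, out of reach of tree packing: as weights are positive, only the empty cut
has value 0. -/
theorem numAlphaMinCuts_le_one (G : WeightedGraph V E) (h : G.minCutValue ≤ 0) {α : ℝ}
    (hα : 0 ≤ α) : G.numAlphaMinCuts α ≤ 1 := by
  refine (Set.ncard_le_ncard (t := {∅}) ?_).trans (Set.ncard_singleton _).le
  rintro F ⟨hF, hle⟩
  exact G.eq_empty_of_cutValue_nonpos (G.subset_edgeSet_of_mem_cuts hF)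
    (hle.trans (mul_nonpos_of_nonneg_of_nonpos hα h))

theorem finite_cuts (G : WeightedGraph V E) : G.cuts.Finite :=
  G.finite_edgeSet.finite_subsets.subset fun _ hF => G.subset_edgeSet_of_mem_cuts hF

theorem finite_alphaMinCuts (G : WeightedGraph V E) (α : ℝ) : (G.alphaMinCuts α).Finite :=
  G.finite_cuts.subset fun _ hF => hF.1

theorem mul_numAlphaMinCuts_le (G : WeightedGraph V E) (hG : G.graph.vertexSet.Nonempty)
    (h : 0 < G.minCutValue) {α : ℝ} {k : ℕ} (hk : 2 * α ≤ k + 1) :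
    (k + 1 - 2 * α) * G.numAlphaMinCuts α ≤
      ∑ j ∈ Finset.range (k + 1), ((G.order - 1).choose j * (k + 1 - j) : ℕ) := by
  classical
  have : Fintype V(G.graph) := G.finite_vertexSet.fintype
  have : Fintype E(G.graph) := G.finite_edgeSet.fintype
  have : Nonempty V(G.graph) := hG.to_subtype
  have hlink : ∀ e : E(G.graph), ∃ x y : V(G.graph), G.graph.IsLink e x y := by
    intro e
    obtain ⟨x, y, hxy⟩ := Graph.exists_isLink_of_mem_edgeSet e.2
    exact ⟨⟨x, hxy.left_mem⟩, ⟨y, hxy.right_mem⟩, hxy⟩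
  choose s t hst using hlink
  have hcross : ∀ S : Set V, ((cutEdges s t fun x => decide (x.1 ∈ S)).map
      (Function.Embedding.subtype _) : Set E) = G.crossing S := by
    intro S
    ext e
    by_cases he : e ∈ E(G.graph)
    · simp only [Finset.coe_map, Function.Embedding.subtype_apply, Set.mem_image, Finset.mem_coe,
        Subtype.exists, exists_and_right, exists_eq_right, he, exists_true_left]
      rw [G.crossing_eq (hst ⟨e, he⟩)]
      simp [cutEdges]
    · refine iff_of_false ?_ fun h => he (G.crossing_subset_edgeSet S h)
      simp [he]
  have hval : ∀ F : Finset E(G.graph), G.cutValue (F.map (Function.Embedding.subtype _) : Set E) =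
      ∑ e ∈ F, G.weight e := by
    intro F
    rw [cutValue, finsum_mem_coe_finset, Finset.sum_map]
    rfl
  -- `A` may also contain the empty edge set from a trivial bipartition; this is harmless for an
  -- upper bound.
  let A : Finset (Finset E(G.graph)) := Finset.univ.filter fun F =>
    F ∈ Set.range (cutEdges s t) ∧ ∑ e ∈ F, G.weight e ≤ α * G.minCutValue
  have hbound := card_cuts_mul_le s t (fun e => G.weight e) (fun e => (G.weight_pos e e.2).le) h
    (by
      rintro f ⟨x, y, hxy⟩
      have hf : f = fun x => decide (x.1 ∈ Subtype.val '' {x | f x = true}) := by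
        funext x
        simp
      rw [← hval, hf, hcross]
      refine G.minCutValue_le ⟨_, ?_, ?_, ?_, rfl⟩
      · rintro _ ⟨v, _, rfl⟩
        exact v.2
      · cases hx : f x with
        | true => exact ⟨x, x, hx, rfl⟩
        | false => exact ⟨y, y, by simpa [hx] using hxy, rfl⟩
      · cases hx : f x with
        | true => exact ⟨y, y.2, by simpa [hx] using hxy⟩
        | false => exact ⟨x, x.2, by simp [hx]⟩)
    α k A (fun F hF => by simpa [A] using hF)
  have hcard : G.numAlphaMinCuts α ≤ A.card := by
    have hsub : G.alphaMinCuts α ⊆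
        (fun F : Finset E(G.graph) => (F.map (Function.Embedding.subtype _) : Set E)) '' A := by
      rintro F ⟨⟨S, -, -, -, rfl⟩, hle⟩
      rw [← hcross, hval] at hle
      exact ⟨_, by simpa [A] using hle, hcross S⟩
    exact (Set.ncard_le_ncard hsub (A.finite_toSet.image _)).trans
      ((Set.ncard_image_le A.finite_toSet).trans (Set.ncard_coe_finset A).le)
  have horder : G.order = Fintype.card V(G.graph) := by
    rw [order, ← Nat.card_coe_set_eq, Nat.card_eq_fintype_card]
  rw [horder]
  exact (mul_le_mul_of_nonneg_left (Nat.cast_le.mpr hcard) (by linarith)).trans hbound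

theorem cuts_nonempty (G : WeightedGraph V E) (h : 2 ≤ G.order) : G.cuts.Nonempty := by
  obtain ⟨x, hx, y, hy, hxy⟩ := (Set.one_lt_ncard G.finite_vertexSet).mp h
  exact ⟨_, {x}, by simpa using hx, by simp, ⟨y, hy, by simpa using hxy.symm⟩, rfl⟩

theorem numAlphaMinCuts_le (G : WeightedGraph V E) {α : ℝ} (hα : 1 ≤ α)
    (hG : ⌊2 * α⌋₊ ≤ G.order) :
    (G.numAlphaMinCuts α : ℝ) ≤ 1 / ((⌊2 * α⌋₊ : ℝ) + 1 - 2 * α) *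
      (G.order.choose ⌊2 * α⌋₊ : ℝ) * (1 + ((⌊2 * α⌋₊ * (⌊2 * α⌋₊ + 1) *
        2 ^ (⌊2 * α⌋₊ - 1) * ⌊2 * α⌋₊ : ℕ) : ℝ) / G.order) := by
  have hk : 2 ≤ ⌊2 * α⌋₊ := Nat.le_floor (by push_cast; linarith)
  have hlt := Nat.lt_floor_add_one (2 * α)
  have hle : (⌊2 * α⌋₊ : ℝ) ≤ 2 * α := Nat.floor_le (by linarith)
  generalize ⌊2 * α⌋₊ = k at *
  rw [mul_assoc, one_div, ← div_eq_inv_mul, le_div_iff₀ (by linarith)]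
  refine le_trans ?_ (sum_choose_mul_le (by omega) hG)
  rcases le_or_gt G.minCutValue 0 with h | h
  · have h1 : (G.numAlphaMinCuts α : ℝ) ≤ 1 := by
      exact_mod_cast G.numAlphaMinCuts_le_one h (by linarith)
    have h2 : (1 : ℝ) ≤ (∑ j ∈ Finset.range (k + 1),
        (G.order - 1).choose j * (k + 1 - j) : ℕ) := by
      rw [Nat.one_le_cast, Finset.sum_range_succ']
      exact Nat.le_add_left_of_le (by simp)
    nlinarith
  · rw [mul_comm]
    refine mul_numAlphaMinCuts_le G ?_ h hlt.le
    rw [← Set.ncard_pos G.finite_vertexSet]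
    exact lt_of_lt_of_le (by omega) hG

/-! ### Cuts of the cycle -/

theorem mem_crossing_cycle {n : ℕ} [NeZero n] {S : Set (ZMod n)} {i : ZMod n} :
    i ∈ (cycle n).crossing S ↔ ¬ (i ∈ S ↔ i + 1 ∈ S) :=
  (cycle n).crossing_eq (.inl ⟨rfl, rfl⟩)

theorem cutValue_cycle {n : ℕ} [NeZero n] (F : Set (ZMod n)) :
    (cycle n).cutValue F = F.ncard := by
  obtain ⟨F, rfl⟩ := F.toFinite.exists_finset_coe
  rw [cutValue, finsum_mem_coe_finset, Set.ncard_coe_finset]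
  simp [cycle]

theorem even_ncard_crossing_cycle {n : ℕ} [NeZero n] (S : Set (ZMod n)) :
    Even ((cycle n).crossing S).ncard := by
  classical
  have hset : (cycle n).crossing S =
      ((Finset.univ.filter fun i => ¬ (i ∈ S ↔ i + 1 ∈ S) : Finset (ZMod n)) : Set (ZMod n)) := by
    ext i
    simp [mem_crossing_cycle]
  rw [hset, Set.ncard_coe_finset, ← ZMod.natCast_eq_zero_iff_even, Finset.card_filter]
  push_cast
  have h : ∀ i : ZMod n, (if ¬ (i ∈ S ↔ i + 1 ∈ S) then 1 else 0 : ZMod 2) =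
      (if i ∈ S then 1 else 0) + (if i + 1 ∈ S then 1 else 0) := by
    intro i
    by_cases h1 : i ∈ S <;> by_cases h2 : i + 1 ∈ S <;> simp [h1, h2]
    decide
  rw [Finset.sum_congr rfl fun i _ => h i, Finset.sum_add_distrib]
  have hshift : ∑ i : ZMod n, (if i + 1 ∈ S then (1 : ZMod 2) else 0) =
      ∑ i : ZMod n, if i ∈ S then 1 else 0 :=
    Equiv.sum_comp (Equiv.addRight (1 : ZMod n)) fun i => if i ∈ S then (1 : ZMod 2) else 0
  rw [hshift]
  exact CharTwo.add_self_eq_zero _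

/-- Going round from 0, switch sides at each edge of `F`; evenness makes the sides agree on return
to 0. -/
theorem exists_crossing_cycle_eq {n : ℕ} [NeZero n] (F : Finset (ZMod n)) (hF : Even F.card) :
    ∃ S, (cycle n).crossing S = F := by
  let S : Set (ZMod n) := {i | Odd (F.filter fun j => j.val < i.val).card}
  refine ⟨S, ?_⟩
  ext i
  rw [mem_crossing_cycle, Finset.mem_coe]
  simp only [S, Set.mem_ofPred_eq]
  have hlt := ZMod.val_lt i
  have hsucc : (F.filter fun j => j.val < i.val + 1).card =
      (F.filter fun j => j.val < i.val).card + if i ∈ F then 1 else 0 := by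
    split_ifs with hi
    · rw [← Finset.card_insert_of_notMem (a := i) (by simp)]
      congr 1
      ext j
      simp only [Finset.mem_filter, Finset.mem_insert, Order.lt_add_one_iff, le_iff_lt_or_eq,
        (ZMod.val_injective n).eq_iff]
      grind
    · rw [add_zero]
      congr 1
      ext j
      simp only [Finset.mem_filter, Order.lt_add_one_iff, le_iff_lt_or_eq,
        (ZMod.val_injective n).eq_iff]
      grind
  have hval : Odd (F.filter fun j => j.val < (i + 1).val).card ↔
      Odd (F.filter fun j => j.val < i.val + 1).card := by
    rcases Nat.lt_or_ge (i.val + 1) n with h | h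
    · have h1 : (i + 1).val = i.val + 1 := by
        rw [ZMod.val_add, ZMod.val_one_eq_one_mod, Nat.add_mod_mod, Nat.mod_eq_of_lt h]
      rw [h1]
    · have h0 : i.val + 1 = n := by omega
      have h1 : (i + 1).val = 0 := by
        rw [ZMod.val_add, ZMod.val_one_eq_one_mod, Nat.add_mod_mod, h0, Nat.mod_self]
      rw [h1, h0, Finset.filter_true_of_mem fun j _ => ZMod.val_lt j]
      simpa using hF
  rw [hval, hsucc]
  split_ifs with hi
  · simp only [hi, iff_true, Nat.odd_add_one]
    tauto
  · simp [hi]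

theorem mem_cuts_cycle {n : ℕ} [NeZero n] {F : Set (ZMod n)} :
    F ∈ (cycle n).cuts ↔ F.Nonempty ∧ Even F.ncard := by
  constructor
  · rintro ⟨S, -, ⟨x, hx⟩, ⟨y, -, hy⟩, rfl⟩
    refine ⟨?_, even_ncard_crossing_cycle S⟩
    by_contra h
    rw [Set.not_nonempty_iff_eq_empty] at h
    have hstep : ∀ i, i ∈ S ↔ i + 1 ∈ S := by
      intro i
      have : i ∉ (cycle n).crossing S := by simp [h]
      simpa [mem_crossing_cycle] using this
    have hadd : ∀ m : ℕ, x + m ∈ S := by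
      intro m
      induction m with
      | zero => simpa using hx
      | succ m ih =>
        rw [Nat.cast_succ, ← add_assoc]
        exact (hstep _).mp ih
    apply hy
    simpa using hadd (y - x).val
  · rintro ⟨⟨e, he⟩, heven⟩
    obtain ⟨F, rfl⟩ := F.toFinite.exists_finset_coe
    rw [Set.ncard_coe_finset] at heven
    obtain ⟨S, hS⟩ := exists_crossing_cycle_eq F heven
    rw [← hS, mem_crossing_cycle] at he
    refine ⟨S, Set.subset_univ S, ?_, ?_, hS.symm⟩
    · by_contra h
      simp [Set.not_nonempty_iff_eq_empty.mp h] at he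
    · by_cases h : e ∈ S
      · exact ⟨e + 1, Set.mem_univ _, fun h' => he (iff_of_true h h')⟩
      · exact ⟨e, Set.mem_univ _, h⟩

theorem minCutValue_cycle {n : ℕ} [NeZero n] (hn : 2 ≤ n) : (cycle n).minCutValue = 2 := by
  refine IsLeast.csInf_eq ⟨?_, ?_⟩
  · have : Fact (1 < n) := ⟨hn⟩
    refine ⟨{0, 1}, mem_cuts_cycle.mpr ⟨by simp, ?_⟩, ?_⟩
    · rw [Set.ncard_pair zero_ne_one]
      exact even_two
    · rw [cutValue_cycle, Set.ncard_pair zero_ne_one]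
      norm_num
  · rintro _ ⟨F, hF, rfl⟩
    rw [mem_cuts_cycle] at hF
    rw [cutValue_cycle]
    have := (Set.ncard_pos F.toFinite).mpr hF.1
    obtain ⟨m, hm⟩ := hF.2
    exact_mod_cast (by omega : 2 ≤ F.ncard)

theorem numAlphaMinCuts_cycle {α : ℝ} (hα : 0 ≤ α) {n : ℕ} [NeZero n] (hn : 2 ≤ n) :
    (cycle n).numAlphaMinCuts α = ∑ j ∈ Finset.Icc 1 ⌊α⌋₊, n.choose (2 * j) := by
  classical
  have hset : (cycle n).alphaMinCuts α = (fun F : Finset (ZMod n) => (F : Set (ZMod n))) ''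
      ((Finset.Icc 1 ⌊α⌋₊).biUnion fun j => Finset.univ.powersetCard (2 * j) :
        Finset (Finset (ZMod n))) := by
    ext F
    obtain ⟨F, rfl⟩ := F.toFinite.exists_finset_coe
    simp only [alphaMinCuts, Set.mem_ofPred_eq, mem_cuts_cycle, cutValue_cycle,
      minCutValue_cycle hn, Set.mem_image, Finset.coe_inj, exists_eq_right, Finset.mem_coe,
      Finset.mem_biUnion, Finset.mem_Icc, Finset.mem_powersetCard, Finset.subset_univ, true_and,
      Set.ncard_coe_finset, Finset.coe_nonempty, ← Finset.card_pos]
    constructor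
    · rintro ⟨⟨hpos, m, hm⟩, hle⟩
      refine ⟨m, ⟨by omega, Nat.le_floor ?_⟩, by omega⟩
      rw [hm] at hle
      push_cast at hle
      linarith
    · rintro ⟨m, ⟨hm1, hm2⟩, hm⟩
      rw [Nat.le_floor_iff hα] at hm2
      rw [hm]
      refine ⟨⟨by omega, even_two_mul m⟩, ?_⟩
      push_cast
      linarith
  rw [numAlphaMinCuts, hset, Set.ncard_image_of_injective _ Finset.coe_injective,
    Set.ncard_coe_finset, Finset.card_biUnion]
  · simp [ZMod.card]
  · intro i _ j _ hij
    rw [Function.onFun, Finset.disjoint_left]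
    intro F hi hj
    rw [Finset.mem_powersetCard] at hi hj
    exact hij (by omega)

/-! ### Parallel paths between two hubs: the lower bound -/

/-- The map of `ℕ` that collapses everything below `k` and everything from `k + N` on. -/
def clip (k N x : ℕ) : ℕ := max (k - 1) (min x (k + N))

/-- The union of `k` internally disjoint paths between the hubs `k - 1` and `k + N`, with `N` inner
vertices altogether: the edge `e < N + k` joins `e` to `e + k`, after all the numbers below `k` have
been identified, and all the numbers from `k + N` on. -/
def theta (k N : ℕ) : WeightedGraph ℕ ℕ where
  graph :=
    { vertexSet := Set.Icc (k - 1) (k + N)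
      IsLink := fun e x y => e < N + k ∧
        ((x = clip k N e ∧ y = clip k N (e + k)) ∨ (x = clip k N (e + k) ∧ y = clip k N e))
      isLink_symm := fun _ _ => ⟨fun _ _ h => ⟨h.1, h.2.elim (fun h => .inr ⟨h.2, h.1⟩)
        (fun h => .inl ⟨h.2, h.1⟩)⟩⟩
      eq_or_eq_of_isLink_of_isLink := by
        rintro e x y v w ⟨-, ⟨rfl, rfl⟩ | ⟨rfl, rfl⟩⟩ ⟨-, ⟨rfl, rfl⟩ | ⟨rfl, rfl⟩⟩ <;> simp
      left_mem_of_isLink := by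
        rintro e x y ⟨-, ⟨rfl, rfl⟩ | ⟨rfl, rfl⟩⟩ <;> simp only [clip, Set.mem_Icc] <;> omega
      edgeSet := Set.Iio (N + k)
      edge_mem_iff_exists_isLink := by
        intro e
        exact ⟨fun h => ⟨_, _, h, .inl ⟨rfl, rfl⟩⟩, fun ⟨_, _, h, _⟩ => h⟩ }
  weight := fun _ => 1
  finite_vertexSet := Set.finite_Icc _ _
  finite_edgeSet := Set.finite_Iio _
  weight_pos := fun _ _ => one_pos

theorem order_theta {k : ℕ} (hk : 1 ≤ k) (N : ℕ) : (theta k N).order = N + 2 := by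
  change (Set.Icc (k - 1) (k + N)).ncard = N + 2
  rw [← Finset.coe_Icc, Set.ncard_coe_finset, Nat.card_Icc]
  omega

theorem mem_crossing_theta {k N : ℕ} {S : Set ℕ} {e : ℕ} :
    e ∈ (theta k N).crossing S ↔
      e < N + k ∧ ¬ (clip k N e ∈ S ↔ clip k N (e + k) ∈ S) := by
  by_cases he : e < N + k
  · rw [(theta k N).crossing_eq (x := clip k N e) (y := clip k N (e + k))
      ⟨he, .inl ⟨rfl, rfl⟩⟩]
    simp [he]
  · exact iff_of_false (fun h => he ((theta k N).crossing_subset_edgeSet S h)) fun h => he h.1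

theorem cutValue_theta {k N : ℕ} {F : Set ℕ} (hF : F ⊆ Set.Iio (N + k)) :
    (theta k N).cutValue F = F.ncard := by
  obtain ⟨F, rfl⟩ := ((Set.finite_Iio _).subset hF).exists_finset_coe
  rw [cutValue, finsum_mem_coe_finset, Set.ncard_coe_finset]
  simp [theta]

/-- A predicate that changes between `x` and `x + m * k` changes at some step of length `k`. -/
theorem exists_step_change (P : ℕ → Prop) (x k m : ℕ) (h : ¬ (P x ↔ P (x + m * k))) :
    ∃ q < m, ¬ (P (x + q * k) ↔ P (x + q * k + k)) := by
  by_contra! hcon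
  have : ∀ j ≤ m, (P x ↔ P (x + j * k)) := by
    intro j
    induction j with
    | zero => simp
    | succ j ih =>
      intro hj
      rw [ih (by omega), hcon j (by omega), add_assoc, Nat.succ_mul]
  exact h (this m le_rfl)

theorem exists_crossing_theta {k N : ℕ} (hk : 1 ≤ k) {S : Set ℕ} {x m : ℕ}
    (h : ¬ (clip k N x ∈ S ↔ clip k N (x + m * k) ∈ S)) :
    ∃ q < m, x + q * k ∈ (theta k N).crossing S := by
  obtain ⟨q, hq, hne⟩ := exists_step_change (fun y => clip k N y ∈ S) x k m h
  refine ⟨q, hq, mem_crossing_theta.mpr ⟨?_, hne⟩⟩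
  -- From `N + k` on, both ends of a step are clipped to the upper hub.
  by_contra! hge
  apply hne
  rw [show clip k N (x + q * k) = clip k N (x + q * k + k) by simp only [clip]; omega]

theorem two_le_ncard_of_mem_cuts_theta {k N : ℕ} (hk : 2 ≤ k) {F : Set ℕ}
    (hF : F ∈ (theta k N).cuts) : 2 ≤ F.ncard := by
  have hfin : F.Finite := (theta k N).finite_edgeSet.subset
    ((theta k N).subset_edgeSet_of_mem_cuts hF)
  suffices h : ∃ a ∈ F, ∃ b ∈ F, a ≠ b by
    obtain ⟨a, ha, b, hb, hab⟩ := h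
    exact (Set.one_lt_ncard hfin).mpr ⟨a, ha, b, hb, hab⟩
  obtain ⟨S, hS, ⟨x, hx⟩, ⟨y, hy, hyS⟩, rfl⟩ := hF
  have hlow : ∀ r < k, clip k N r = k - 1 := by
    intro r hr
    simp only [clip]
    omega
  have hhigh : ∀ r, clip k N (r + (N + k) * k) = k + N := by
    intro r
    have : N + k ≤ (N + k) * k := Nat.le_mul_of_pos_right _ (by omega)
    simp only [clip]
    omega
  -- If the hubs are on the same side, some `z` is separated from both, and the path through `z`
  -- crosses before and after it. Otherwise every path crosses, and residues 0 and 1 give different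
  -- edges.
  by_cases hhub : k - 1 ∈ S ↔ k + N ∈ S
  · obtain ⟨z, hz1, hz2, hz⟩ : ∃ z, k - 1 ≤ z ∧ z ≤ k + N ∧ ¬ (z ∈ S ↔ k - 1 ∈ S) := by
      by_cases h : k - 1 ∈ S
      · exact ⟨y, hy.1, hy.2, fun h' => hyS (h'.mpr h)⟩
      · exact ⟨x, (hS hx).1, (hS hx).2, fun h' => h (h'.mp hx)⟩
    have hclip : clip k N z = z := by
      simp only [clip]
      omega
    have hmod : z % k + z / k * k = z := by
      rw [mul_comm]
      exact Nat.mod_add_div z k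
    obtain ⟨q, hq, hqS⟩ := exists_crossing_theta (k := k) (N := N) (S := S) (x := z % k)
      (m := z / k) (by omega) (by
        rw [hmod, hclip, hlow _ (Nat.mod_lt _ (by omega))]
        tauto)
    obtain ⟨q', hq', hqS'⟩ := exists_crossing_theta (k := k) (N := N) (S := S) (x := z)
      (m := N + k) (by omega) (by
        rw [hhigh, hclip]
        tauto)
    refine ⟨_, hqS, _, hqS', ?_⟩
    have : q * k < z / k * k := Nat.mul_lt_mul_of_pos_right hq (by omega)
    omega
  · have hpath : ∀ r < k, ∃ q < N + k, r + q * k ∈ (theta k N).crossing S := by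
      intro r hr
      exact exists_crossing_theta (by omega) (by rwa [hlow r hr, hhigh])
    obtain ⟨q, -, hq⟩ := hpath 0 (by omega)
    obtain ⟨q', -, hq'⟩ := hpath 1 (by omega)
    refine ⟨_, hq, _, hq', fun h => ?_⟩
    have := congrArg (· % k) h
    simp [Nat.mod_eq_of_lt (show 1 < k by omega)] at this

theorem two_le_minCutValue_theta {k : ℕ} (hk : 2 ≤ k) (N : ℕ) :
    2 ≤ (theta k N).minCutValue := by
  refine le_csInf (((theta k N).cuts_nonempty ?_).image _) ?_
  · rw [order_theta (by omega)]
    omega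
  · rintro _ ⟨F, hF, rfl⟩
    rw [cutValue_theta ((theta k N).subset_edgeSet_of_mem_cuts hF)]
    exact_mod_cast two_le_ncard_of_mem_cuts_theta hk hF

/-- One edge from each of the `k` paths. -/
def transversal {k M : ℕ} (q : Fin k → Fin M) : Finset ℕ :=
  Finset.univ.image fun r => r.val + (q r).val * k

theorem mem_transversal {k M : ℕ} {q : Fin k → Fin M} (r : Fin k) (e : ℕ) (he : e % k = r) :
    e ∈ transversal q ↔ e / k = q r := by
  have hk : 0 < k := r.pos
  simp only [transversal, Finset.mem_image, Finset.mem_univ, true_and]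
  constructor
  · rintro ⟨r', rfl⟩
    have : r' = r := by
      ext
      rw [← he, Nat.add_mul_mod_self_right, Nat.mod_eq_of_lt r'.2]
    rw [this, Nat.add_mul_div_right _ _ hk, Nat.div_eq_of_lt r.2, zero_add]
  · intro h
    refine ⟨r, ?_⟩
    rw [← h, ← he, mul_comm]
    exact Nat.mod_add_div e k

theorem transversal_injective (k M : ℕ) :
    Function.Injective (transversal : (Fin k → Fin M) → Finset ℕ) := by
  intro q q' h
  funext r
  have hmod : (r.val + (q r).val * k) % k = r := by
    rw [Nat.add_mul_mod_self_right, Nat.mod_eq_of_lt r.2]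
  have hdiv : (r.val + (q r).val * k) / k = q r := by
    rw [Nat.add_mul_div_right _ _ r.pos, Nat.div_eq_of_lt r.2, zero_add]
  have h1 := (mem_transversal r _ hmod).mpr hdiv
  rw [h, mem_transversal r _ hmod, hdiv] at h1
  exact Fin.ext h1

theorem transversal_mem_cuts {k N : ℕ} (hk : 1 ≤ k) (q : Fin k → Fin (N / k + 1)) :
    (transversal q : Set ℕ) ∈ (theta k N).cuts := by
  have hqN : ∀ r, (q r).val * k ≤ N := fun r =>
    (Nat.mul_le_mul_right k (Nat.le_of_lt_succ (q r).2)).trans (Nat.div_mul_le_self N k)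
  -- The number `x` has position `x / k` on path `x % k`; each path is kept up to position `q`. The
  -- guard `k ≤ x` puts the lower hub `k - 1` in `S` unconditionally.
  let S : Set ℕ := {x | k - 1 ≤ x ∧ x < k + N ∧
    (k ≤ x → x / k ≤ (q ⟨x % k, Nat.mod_lt _ hk⟩).val)}
  have hlow : ∀ x < k, clip k N x ∈ S := by
    intro x hx
    simp only [S, clip, Set.mem_ofPred_eq]
    refine ⟨by omega, by omega, fun h => by omega⟩
  have hhigh : ∀ x, k + N ≤ x → clip k N x ∉ S := by
    intro x hx h
    simp only [S, clip, Set.mem_ofPred_eq] at h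
    omega
  have hmid : ∀ x, k ≤ x → x < k + N →
      (clip k N x ∈ S ↔ x / k ≤ (q ⟨x % k, Nat.mod_lt _ hk⟩).val) := by
    intro x h1 h2
    have hclip : clip k N x = x := by
      simp only [clip]
      omega
    rw [hclip]
    simp only [S, Set.mem_ofPred_eq]
    exact ⟨fun h => h.2.2 h1, fun h => ⟨by omega, h2, fun _ => h⟩⟩
  have hall : ∀ x < k + N, (clip k N x ∈ S ↔ x / k ≤ (q ⟨x % k, Nat.mod_lt _ hk⟩).val) := by
    intro x hx
    by_cases h : k ≤ x
    · exact hmid x h hx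
    · rw [Nat.div_eq_of_lt (by omega)]
      exact iff_of_true (hlow x (by omega)) (Nat.zero_le _)
  have hall' : ∀ e < k + N,
      (clip k N (e + k) ∈ S ↔ e / k + 1 ≤ (q ⟨e % k, Nat.mod_lt _ hk⟩).val) := by
    intro e he
    by_cases h : e + k < k + N
    · rw [hall _ h]
      simp only [Nat.add_div_right e hk, Nat.add_mod_right]
    · refine iff_of_false (hhigh _ (by omega)) fun h' => ?_
      have h1 := hqN ⟨e % k, Nat.mod_lt _ hk⟩
      have h2 := Nat.mul_le_mul_right k h'
      have h3 := Nat.mod_add_div e k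
      have h4 := Nat.mod_lt e hk
      rw [add_mul, one_mul, mul_comm] at h2
      omega
  refine ⟨S, ?_, ?_, ?_, ?_⟩
  · rintro x ⟨h1, h2, -⟩
    exact ⟨h1, h2.le⟩
  · exact ⟨_, hlow 0 hk⟩
  · refine ⟨k + N, ⟨by omega, le_rfl⟩, fun h => ?_⟩
    exact absurd h.2.1 (lt_irrefl _)
  · ext e
    rw [Finset.mem_coe, mem_transversal ⟨e % k, Nat.mod_lt _ hk⟩ e rfl, mem_crossing_theta]
    constructor
    · intro h
      have he : e < k + N := by
        have h1 := hqN ⟨e % k, Nat.mod_lt _ hk⟩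
        have h3 := Nat.mod_add_div e k
        have h4 := Nat.mod_lt e hk
        rw [← h, mul_comm] at h1
        omega
      rw [hall e he, hall' e he]
      omega
    · rintro ⟨he, h⟩
      rw [hall e (by omega), hall' e (by omega)] at h
      omega

theorem pow_le_numAlphaMinCuts_theta {α : ℝ} {k : ℕ} (hk : 2 ≤ k) (hkα : (k : ℝ) ≤ 2 * α)
    (N : ℕ) : (N / k + 1) ^ k ≤ (theta k N).numAlphaMinCuts α := by
  have hsub : ((fun F : Finset ℕ => (F : Set ℕ)) ∘ transversal) ''
      (Set.univ : Set (Fin k → Fin (N / k + 1))) ⊆ (theta k N).alphaMinCuts α := by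
    rintro _ ⟨q, -, rfl⟩
    have hq := transversal_mem_cuts (by omega) q
    refine ⟨hq, ?_⟩
    rw [Function.comp_apply, cutValue_theta ((theta k N).subset_edgeSet_of_mem_cuts hq),
      Set.ncard_coe_finset]
    have h1 : ((transversal q).card : ℝ) ≤ k := by
      exact_mod_cast Finset.card_image_le.trans (by simp)
    have h2 := two_le_minCutValue_theta hk N
    have h3 : (2 : ℝ) ≤ k := by exact_mod_cast hk
    nlinarith
  have := Set.ncard_le_ncard hsub ((theta k N).finite_alphaMinCuts α)
  rwa [Set.ncard_image_of_injective _
    (Finset.coe_injective.comp (transversal_injective _ _)), Set.ncard_univ,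
    Nat.card_eq_fintype_card, Fintype.card_fun, Fintype.card_fin, Fintype.card_fin] at this

/-! ### Order of growth of the maximum -/

/-- Needed because `sSup` of an unbounded set of naturals is 0. -/
theorem bddAbove_numAlphaMinCuts {α : ℝ} (hα : 1 ≤ α) {n : ℕ} (hn : ⌊2 * α⌋₊ ≤ n) :
    BddAbove {N | ∃ G : WeightedGraph ℕ ℕ, G.order = n ∧ N = G.numAlphaMinCuts α} := by
  refine ⟨⌊1 / ((⌊2 * α⌋₊ : ℝ) + 1 - 2 * α) * (n.choose ⌊2 * α⌋₊ : ℝ) *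
    (1 + ((⌊2 * α⌋₊ * (⌊2 * α⌋₊ + 1) * 2 ^ (⌊2 * α⌋₊ - 1) * ⌊2 * α⌋₊ : ℕ) : ℝ) / n)⌋₊, ?_⟩
  rintro _ ⟨G, rfl, rfl⟩
  exact Nat.le_floor (G.numAlphaMinCuts_le hα hn)

theorem maxNumAlphaMinCuts_le {α : ℝ} (hα : 1 ≤ α) {n : ℕ} (hn : ⌊2 * α⌋₊ ≤ n) :
    (maxNumAlphaMinCuts α n : ℝ) ≤ 1 / ((⌊2 * α⌋₊ : ℝ) + 1 - 2 * α) *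
      (n.choose ⌊2 * α⌋₊ : ℝ) * (1 + ((⌊2 * α⌋₊ * (⌊2 * α⌋₊ + 1) *
        2 ^ (⌊2 * α⌋₊ - 1) * ⌊2 * α⌋₊ : ℕ) : ℝ) / n) := by
  have hk : 2 ≤ ⌊2 * α⌋₊ := Nat.le_floor (by push_cast; linarith)
  obtain ⟨G, hG, hmax⟩ := Nat.sSup_mem (s := {N | ∃ G : WeightedGraph ℕ ℕ, G.order = n ∧
    N = G.numAlphaMinCuts α}) ⟨_, theta 2 (n - 2), by rw [order_theta one_le_two]; omega, rfl⟩
    (bddAbove_numAlphaMinCuts hα hn)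
  rw [maxNumAlphaMinCuts, hmax]
  subst hG
  exact G.numAlphaMinCuts_le hα hn

theorem isTheta_maxNumAlphaMinCuts {α : ℝ} (hα : 1 ≤ α) :
    (fun n : ℕ => (maxNumAlphaMinCuts α n : ℝ)) =Θ[Filter.atTop]
      fun n : ℕ => (n : ℝ) ^ ⌊2 * α⌋₊ := by
  have hk : 2 ≤ ⌊2 * α⌋₊ := Nat.le_floor (by push_cast; linarith)
  have hlt := Nat.lt_floor_add_one (2 * α)
  have hle : (⌊2 * α⌋₊ : ℝ) ≤ 2 * α := Nat.floor_le (by linarith)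
  constructor
  · refine Asymptotics.IsBigO.of_bound (1 / ((⌊2 * α⌋₊ : ℝ) + 1 - 2 * α) *
      (1 + ((⌊2 * α⌋₊ * (⌊2 * α⌋₊ + 1) * 2 ^ (⌊2 * α⌋₊ - 1) * ⌊2 * α⌋₊ : ℕ) : ℝ))) ?_
    filter_upwards [Filter.eventually_ge_atTop ⌊2 * α⌋₊] with n hn
    have h := maxNumAlphaMinCuts_le hα hn
    generalize (⌊2 * α⌋₊ * (⌊2 * α⌋₊ + 1) * 2 ^ (⌊2 * α⌋₊ - 1) * ⌊2 * α⌋₊ : ℕ) = K at *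
    have hpos : 0 ≤ 1 / ((⌊2 * α⌋₊ : ℝ) + 1 - 2 * α) := one_div_nonneg.mpr (by linarith)
    rw [Real.norm_of_nonneg (Nat.cast_nonneg _), Real.norm_of_nonneg (by positivity)]
    refine h.trans ?_
    rw [mul_assoc, mul_assoc, mul_comm (1 + (K : ℝ))]
    refine mul_le_mul_of_nonneg_left (mul_le_mul ?_ ?_ (by positivity) (by positivity)) hpos
    · exact_mod_cast Nat.choose_le_pow n _
    · have : (1 : ℝ) ≤ n := by exact_mod_cast (by omega : 1 ≤ n)
      linarith [div_le_self (Nat.cast_nonneg (α := ℝ) K) this]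
  · refine Asymptotics.IsBigO.of_bound ((2 * ⌊2 * α⌋₊ : ℝ) ^ ⌊2 * α⌋₊) ?_
    filter_upwards [Filter.eventually_ge_atTop ⌊2 * α⌋₊] with n hn
    rw [Real.norm_of_nonneg (by positivity), Real.norm_of_nonneg (Nat.cast_nonneg _)]
    have h1 : ((n - 2) / ⌊2 * α⌋₊ + 1) ^ ⌊2 * α⌋₊ ≤ maxNumAlphaMinCuts α n :=
      (pow_le_numAlphaMinCuts_theta hk hle (n - 2)).trans
        (le_csSup (bddAbove_numAlphaMinCuts hα hn)
          ⟨_, by rw [order_theta (by omega)]; omega, rfl⟩)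
    -- Division gives `n - 2 < k * ((n - 2) / k + 1)` with `k = ⌊2α⌋`; the factor 2 absorbs the two
    -- hubs.
    have h2 : n ≤ 2 * ⌊2 * α⌋₊ * ((n - 2) / ⌊2 * α⌋₊ + 1) := by
      have := Nat.lt_mul_div_succ (n - 2) (show 0 < ⌊2 * α⌋₊ by omega)
      rw [mul_assoc]
      omega
    calc (n : ℝ) ^ ⌊2 * α⌋₊
        ≤ (2 * ⌊2 * α⌋₊ * ((n - 2) / ⌊2 * α⌋₊ + 1 : ℕ) : ℝ) ^ ⌊2 * α⌋₊ :=
          pow_le_pow_left₀ (Nat.cast_nonneg _) (by exact_mod_cast h2) _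
      _ = (2 * ⌊2 * α⌋₊ : ℝ) ^ ⌊2 * α⌋₊ *
          (((n - 2) / ⌊2 * α⌋₊ + 1 : ℕ) ^ ⌊2 * α⌋₊ : ℕ) := by
          rw [mul_pow]
          push_cast
          rfl
      _ ≤ _ := mul_le_mul_of_nonneg_left (Nat.cast_le.mpr h1) (by positivity)

end WeightedGraph

theorem mainTheorem2 :
    -- the upper bound; the constant `K` in the `O(1/n)` term depends only on `⌊2α⌋`
    (∀ k : ℕ, ∃ K : ℝ, ∀ α : ℝ, 1 ≤ α → ⌊2 * α⌋₊ = k →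
      ∀ (V E : Type*) (G : WeightedGraph V E), k ≤ G.order →
        (G.numAlphaMinCuts α : ℝ) ≤
          1 / ((k : ℝ) + 1 - 2 * α) * (G.order.choose k : ℝ) * (1 + K / (G.order : ℝ))) ∧
    -- the order of growth, for every fixed `α`
    (∀ α : ℝ, 1 ≤ α →
      (fun n : ℕ => (WeightedGraph.maxNumAlphaMinCuts α n : ℝ)) =Θ[Filter.atTop]
        fun n : ℕ => (n : ℝ) ^ ⌊2 * α⌋₊) ∧
    -- the number of `α`-minimum cuts of the cycle
    (∀ α : ℝ, 1 ≤ α → ∀ (n : ℕ) [NeZero n], 2 ≤ n →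
      (WeightedGraph.cycle n).numAlphaMinCuts α =
        ∑ j ∈ Finset.Icc 1 ⌊α⌋₊, n.choose (2 * j)) := by
  refine ⟨fun k => ⟨(k * (k + 1) * 2 ^ (k - 1) * k : ℕ), ?_⟩,
    fun α hα => WeightedGraph.isTheta_maxNumAlphaMinCuts hα,
    fun α hα n _ hn => WeightedGraph.numAlphaMinCuts_cycle (by linarith) hn⟩
  rintro α hα rfl V E G hG
  exact G.numAlphaMinCuts_le hα hG
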